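/- Let $G=(V,E)$ be a finite directed graph without loops, with a source $s$ and a target $t$ joined by at least one path. A path from $s$ to $t$ is a sequence of distinct vertices along edges of $E$, and is identified with its set of edges. Each edge $e$ has an unknown mean-reward parameter $\theta_e$ and known hyper-parameters $\mu_e\in\mathbb R$, $\varsigma_e>0$, $\sigma_e>0$. One of the following three models is used on all edges; in each of them the $\theta_e$ are independent, and given $\theta$ the energies $\tilde E_{e}$ are independent over edges and rounds. * Gaussian: $\theta_e\sim\mathcal N(\mu_e,\varsigma_e^2)$, $\tilde E_e\mid\theta_e\sim\mathcal N(-\theta_e,\sigma_e^2)$, with edge cost $z_e=\tilde E_e$. * Rectified Gaussian: the same prior and likelihood, with edge cost $z_e=\max(0,\tilde E_e)$ (the unrectified $\tilde E_e$ is observed). * Log-Gaussian ($\mu_e<0$): $\log(-\theta_e)\sim\mathcal N\big(\log(-\mu_e)-\tfrac12 L_e,\,L_e\big)$ with $L_e=\log(1+\varsigma_e^2/\mu_e^2)$, and $\log\tilde E_e\mid\theta_e\sim\mathcal N\big(\log(-\theta_e)-\tfrac12\ell_e,\,\ell_e\big)$ with $\ell_e=\log(1+\sigma_e^2/\mu_e^2)$,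 with edge cost $z_e=\tilde E_e$. Write $w_e(\theta)=\mathbb E[z_e\mid\theta_e]$. Thompson Sampling does the following in each round $t=1,\dots,T$: it samples $\tilde\theta$ from the current posterior of $\theta$, plays a path $a_t$ of least total weight $\sum_{e\in a}w_e(\tilde\theta)$ (found by any exact shortest-path solver with a fixed measurable rule for ties), observes $\tilde E_e$ for the edges $e\in a_t$ only, and updates the posterior by the conjugate Bayes rule. Its Bayesian regret is $$\mathrm{BayesRegret}(T)=\mathbb E\Big[\sum_{t=1}^T\Big(\sum_{e\in a_t}w_e(\theta)-\min_{a}\sum_{e\in a}w_e(\theta)\Big)\Big],$$ where the minimum is over all paths from $s$ to $t$ and the expectation is also over $\theta$ drawn from the prior. **Proposition.** $\mathrm{BayesRegret}(T)\le\tilde{\mathcal O}\big(|V|^2\sqrt{|E|\,T}\big)$. Precisely: for each of the three models and every $M$ there are constants $C$ and $k$, depending only on the model and $M$, such that for every such graph, all $s$, $t$, every solver, every $T\ge 0$ and all hyper-parameters with $\varsigma_e\le M$ and $\sigma_e\le M$ for all $e$ (in the log-Gaussian model: $|\mu_e|\le M$, $\varsigma_e\le M|\mu_e|$ and $\sigma_e\le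 M$), $$\mathrm{BayesRegret}(T)\le C\,|V|^2\sqrt{|E|\,T}\,\big(1+\log(|V|\,|E|\,T)\big)^k,$$ where $\log 0$ is read as $0$. -/

import Mathlib

open MeasureTheory ProbabilityTheory
open scoped NNReal ENNReal

noncomputable section

namespace Navigation

/-! ### Paths in the road network and exact shortest-path solvers -/

section Paths

variable {V : Type*} [DecidableEq V]

/-- A directed path `⟨u₁, …, uₙ⟩` from `s` to `t` in the directed graph with edge set `E`,
without repeated vertices. -/
def IsPath (E : Finset (V × V)) (s t : V) (p : List V) : Prop :=
  p.head? = some s ∧ p.getLast? = some t ∧ p.Nodup ∧ p.IsChain (fun u v => (u, v) ∈ E)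

/-- The edges `(uₕ, uₕ₊₁)` of a vertex sequence. -/
def pathEdges (E : Finset (V × V)) (p : List V) : Finset E :=
  Finset.univ.filter (fun e : E => e.1 ∈ p.zip p.tail)

/-- The feasible super-arms: the edge sets of the paths from `s` to `t`. -/
def superArms (E : Finset (V × V)) (s t : V) : Set (Finset E) :=
  {a | ∃ p : List V, IsPath E s t p ∧ a = pathEdges E p}

/-- An exact (deterministic) shortest-path algorithm: for each weight vector `w` it returns a
path from `s` to `t` of least total weight. Ties are broken in any measurable way. -/
structure ShortestPathSolver (E : Finset (V × V)) (s t : V) where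
  /-- the path returned for a weight vector -/
  arm : (E → ℝ) → Finset E
  arm_mem : ∀ w, arm w ∈ superArms E s t
  arm_le : ∀ w, ∀ b ∈ superArms E s t, ∑ e ∈ arm w, w e ≤ ∑ e ∈ b, w e
  measurableSet_arm : ∀ a, MeasurableSet {w | arm w = a}

end Paths

/-! ### The Bayesian energy models -/

/-- The probabilistic models for the energy `Ẽ` used on an edge with mean-reward parameter `θ`. -/
inductive EnergyModel where
  /-- `Ẽ ∼ N(-θ, σ²)`, and the cost of the edge is `Ẽ` itself. -/
  | gaussian
  /-- `Ẽ ∼ N(-θ, σ²)`, and the cost of the edge is `max(0, Ẽ)`. -/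
  | rectifiedGaussian
  /-- `Ẽ` is log-Gaussian with mean `-θ`, and the cost of the edge is `Ẽ`. -/
  | logGaussian

/-- Hyper-parameters of one edge: the prior mean `μ₀` and prior standard deviation `ς₀` of the
mean reward `θ`, and the noise parameter `σ`. -/
structure EdgeHyper where
  mean : ℝ
  sd : ℝ≥0
  noise : ℝ≥0

/-- The log-Gaussian distribution: the law of `exp X` with `X ∼ N(m, v)`. -/
def logGaussianReal (m : ℝ) (v : ℝ≥0) : Measure ℝ := (gaussianReal m v).map Real.exp

namespace EdgeHyper

variable (h : EdgeHyper)

/-- Log-Gaussian model: the variance `log (1 + ς₀² / μ₀²)` of `log (-θ)` under the prior. -/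
def logPriorVar : ℝ≥0 := (Real.log (1 + (h.sd : ℝ) ^ 2 / h.mean ^ 2)).toNNReal

/-- Log-Gaussian model: the variance `log (1 + σ² / μ₀²)` of `log Ẽ` given `θ`. -/
def logNoiseVar : ℝ≥0 := (Real.log (1 + (h.noise : ℝ) ^ 2 / h.mean ^ 2)).toNNReal

/-- The parameters `(m, v)` of the prior. In the two Gaussian models they are the mean and the
variance of `θ`, in the log-Gaussian model those of `log (-θ)`. -/
def prior : EnergyModel → ℝ × ℝ≥0
  | .gaussian => (h.mean, h.sd ^ 2)
  | .rectifiedGaussian => (h.mean, h.sd ^ 2)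
  | .logGaussian => (Real.log (-h.mean) - (h.logPriorVar : ℝ) / 2, h.logPriorVar)

/-- The law of the energy `Ẽ` given the mean reward `θ`. -/
def energyLaw : EnergyModel → ℝ → Measure ℝ
  | .gaussian, θ => gaussianReal (-θ) (h.noise ^ 2)
  | .rectifiedGaussian, θ => gaussianReal (-θ) (h.noise ^ 2)
  | .logGaussian, θ =>
      logGaussianReal (Real.log (-θ) - (h.logNoiseVar : ℝ) / 2) h.logNoiseVar

/-- The expected cost of the edge given the mean reward `θ`; it is the weight of the edge in the
shortest path problem, and the expected reward is its negative. -/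
def weight : EnergyModel → ℝ → ℝ
  | .gaussian, θ => ∫ x, x ∂(h.energyLaw .gaussian θ)
  | .rectifiedGaussian, θ => ∫ x, max 0 x ∂(h.energyLaw .rectifiedGaussian θ)
  | .logGaussian, θ => ∫ x, x ∂(h.energyLaw .logGaussian θ)

/-- The conjugate Gaussian update of `(m, v)` after an observation `y ∼ N(·, u)`. -/
def gaussianUpdate (u : ℝ≥0) (q : ℝ × ℝ≥0) (y : ℝ) : ℝ × ℝ≥0 :=
  let v' : ℝ≥0 := (1 / q.2 + 1 / u)⁻¹
  ((v' : ℝ) * (q.1 / q.2 + y / u), v')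

/-- The Bayesian update of the parameters of the edge after the energy `x` was observed. -/
def update : EnergyModel → ℝ × ℝ≥0 → ℝ → ℝ × ℝ≥0
  | .gaussian, q, x => gaussianUpdate (h.noise ^ 2) q (-x)
  | .rectifiedGaussian, q, x => gaussianUpdate (h.noise ^ 2) q (-x)
  | .logGaussian, q, x =>
      gaussianUpdate h.logNoiseVar q (Real.log x + (h.logNoiseVar : ℝ) / 2)

/-- The hyper-parameters are admissible and bounded in terms of `M`. -/
def BoundedBy (M : ℝ) : EnergyModel → Prop
  | .gaussian => 0 < h.sd ∧ 0 < h.noise ∧ h.sd ≤ M ∧ h.noise ≤ M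
  | .rectifiedGaussian => 0 < h.sd ∧ 0 < h.noise ∧ h.sd ≤ M ∧ h.noise ≤ M
  | .logGaussian => 0 < h.sd ∧ 0 < h.noise ∧ h.mean < 0 ∧
      -h.mean ≤ M ∧ h.sd ≤ M * -h.mean ∧ h.noise ≤ M

end EdgeHyper

/-- The law of the mean reward `θ` of one edge when the current parameters are `(m, v)`. -/
def belief : EnergyModel → ℝ × ℝ≥0 → Measure ℝ
  | .gaussian, q => gaussianReal q.1 q.2
  | .rectifiedGaussian, q => gaussianReal q.1 q.2
  | .logGaussian, q => (logGaussianReal q.1 q.2).map (fun x => -x)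

/-! ### Thompson Sampling and its Bayesian regret -/

section Regret

variable {V : Type*} [DecidableEq V] {E : Finset (V × V)} {s t : V}

/-- The vector of edge weights for the mean reward vector `θ`. -/
def weights (mod : EnergyModel) (h : E → EdgeHyper) (θ : E → ℝ) : E → ℝ :=
  fun e => (h e).weight mod (θ e)

/-- The instant regret `E[r(a*)] - E[r(a)]` of the super-arm `a`, where `r` is the negative cost
and `a*` is an optimal super-arm for the mean reward vector `θ`. -/
def gap (mod : EnergyModel) (h : E → EdgeHyper) (sol : ShortestPathSolver E s t)
    (θ : E → ℝ) (a : Finset E) : ℝ :=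
  ∑ e ∈ a, weights mod h θ e - ∑ e ∈ sol.arm (weights mod h θ), weights mod h θ e

/-- The updated parameters after the super-arm `a` was played and the energies `x e`, `e ∈ a`,
were observed (semi-bandit feedback: the other coordinates of `x` are not used). -/
def updateParameters (mod : EnergyModel) (h : E → EdgeHyper) (p : E → ℝ × ℝ≥0)
    (a : Finset E) (x : E → ℝ) : E → ℝ × ℝ≥0 :=
  fun e => if e ∈ a then (h e).update mod (p e) (x e) else p e

/-- The expected regret, for the true mean reward vector `θ`, of `n` further rounds of Thompson
Sampling started with the posterior parameters `p`. In each round a vector `θ'` is sampled from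
the current posterior, a shortest path `a` for the weights given by `θ'` is played, the energies
`x` are drawn (independently over the edges) given the true `θ`, and the parameters of the edges
of `a` are updated. -/
def expectedRegret (mod : EnergyModel) (h : E → EdgeHyper) (sol : ShortestPathSolver E s t)
    (θ : E → ℝ) : ℕ → (E → ℝ × ℝ≥0) → ℝ≥0∞
  | 0, _ => 0
  | n + 1, p =>
      ∫⁻ θ', ∫⁻ x,
          (ENNReal.ofReal (gap mod h sol θ (sol.arm (weights mod h θ'))) +
            expectedRegret mod h sol θ n
              (updateParameters mod h p (sol.arm (weights mod h θ')) x))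
        ∂(Measure.pi fun e => (h e).energyLaw mod (θ e))
      ∂(Measure.pi fun e => belief mod (p e))

/-- The Bayesian regret of Thompson Sampling with horizon `T`: the expected regret when the true
mean reward vector is drawn from the prior. -/
def bayesRegret (mod : EnergyModel) (h : E → EdgeHyper) (sol : ShortestPathSolver E s t)
    (T : ℕ) : ℝ≥0∞ :=
  ∫⁻ θ, expectedRegret mod h sol θ T (fun e => (h e).prior mod)
    ∂(Measure.pi fun e => belief mod ((h e).prior mod))

end Regret

end Navigation

end

/-! Given the history, the true parameter θ and the sample θ' are independent with the same law, the
current belief. Exchanging them exchanges the two optimal paths, so in the sum of the two regrets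
the optimal values pair up, and at most the sum of |w_e(θ) - w_e(θ')| over the edges of the two
played paths remains (`gap_add_gap_le`, `lintegral_lintegral_gap_le_abs`).

Let v be the current variance of the conjugate parameter of an edge, c its `scale`, and x the
difference of its two weights. Young's inequality gives |x| ≤ l v c² / 2 + x² / (2 l v c²). Every
observation adds a fixed amount to the precision 1/v, so v c² ≤ D / (k + 1) after k observations;
the first term is paid only when the edge is played, and its payments form a harmonic sum. The mean
of x² is at most v times `fluctuation`, so v cancels in the second term, which costs `fluctuation` /
(2 l c²) per edge and round. The fluctuation is a martingale under Bayes updates, hence keeps its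
prior mean, which is of order c². Induction on the horizon (`regretFrom_le`) adds up both terms.
With l = √T every edge contributes O(√T (1 + log T)), and |E| √T = √|E| √(|E| T) ≤ |V|² √(|E| T).

Bayes' rule is used without conditional laws: all randomness comes from standard normal variables,
and a rotation turns the pair (prior draw, noise) into the pair (posterior draw, observation); see
`lintegral_lintegral_bayes`. -/

noncomputable section

namespace Navigation

/-! ### Standard normal coordinates for beliefs -/

/-- The standard normal law on the real line. -/
abbrev stdNormal : Measure ℝ := gaussianReal 0 1

/-- Either square root of the variance is admitted: the energies use the negative one. -/
theorem gaussianReal_eq_map_stdNormal (m : ℝ) (v : ℝ≥0) (c : ℝ) (hc : c ^ 2 = v) :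
    gaussianReal m v = stdNormal.map (fun a => m + c * a) := by
  have h1 := gaussianReal_map_const_mul (μ := 0) (v := 1) c
  have h2 : stdNormal.map (fun a => m + c * a) = (stdNormal.map (c * ·)).map (m + ·) := by
    rw [Measure.map_map (by fun_prop) (by fun_prop)]; rfl
  rw [h2, h1, gaussianReal_map_const_add]
  congr 1
  · simp
  · ext; simp [hc]

/-- The mean reward as a function of its conjugate Gaussian parameter. -/
def decode : EnergyModel → ℝ → ℝ
  | .gaussian, y => y
  | .rectifiedGaussian, y => y
  | .logGaussian, y => -Real.exp y

theorem measurable_decode (mod : EnergyModel) : Measurable (decode mod) := by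
  cases mod
  · exact measurable_id
  · exact measurable_id
  · exact Real.measurable_exp.neg

/-- A mean reward with law `belief mod q`, as a function of a standard normal variable. -/
def draw (mod : EnergyModel) (q : ℝ × ℝ≥0) (a : ℝ) : ℝ := decode mod (q.1 + √(q.2 : ℝ) * a)

theorem measurable_uncurry_draw (mod : EnergyModel) :
    Measurable fun z : (ℝ × ℝ≥0) × ℝ => draw mod z.1 z.2 := by
  unfold draw
  exact (measurable_decode mod).comp (by fun_prop)

theorem measurable_draw (mod : EnergyModel) (q : ℝ × ℝ≥0) : Measurable (draw mod q) :=
  (measurable_uncurry_draw mod).comp measurable_prodMk_left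

theorem map_draw_stdNormal (mod : EnergyModel) (q : ℝ × ℝ≥0) :
    stdNormal.map (draw mod q) = belief mod q := by
  have h := gaussianReal_eq_map_stdNormal q.1 q.2 (√(q.2 : ℝ)) (Real.sq_sqrt q.2.2)
  cases mod
  · exact h.symm
  · exact h.symm
  · simp only [belief, logGaussianReal]
    rw [h, Measure.map_map (by fun_prop) (by fun_prop), Measure.map_map (by fun_prop) (by fun_prop)]
    rfl

/-! ### Energies and conjugate updates in standard normal coordinates -/

namespace EdgeHyper

variable (h : EdgeHyper)

/-- The variance of the Gaussian observation of the conjugate parameter. -/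
def obsVar : EnergyModel → ℝ≥0
  | .gaussian => h.noise ^ 2
  | .rectifiedGaussian => h.noise ^ 2
  | .logGaussian => h.logNoiseVar

/-- An energy with law `energyLaw mod θ`, as a function of a standard normal variable. -/
def energy : EnergyModel → ℝ → ℝ → ℝ
  | .gaussian, θ, z => -θ - h.noise * z
  | .rectifiedGaussian, θ, z => -θ - h.noise * z
  | .logGaussian, θ, z =>
      Real.exp (Real.log (-θ) - (h.logNoiseVar : ℝ) / 2 + √(h.logNoiseVar : ℝ) * z)

theorem measurable_uncurry_energy (mod : EnergyModel) :
    Measurable fun z : ℝ × ℝ => h.energy mod z.1 z.2 := by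
  cases mod <;> simp only [energy] <;> fun_prop

theorem measurable_energy (mod : EnergyModel) (θ : ℝ) : Measurable (h.energy mod θ) :=
  (h.measurable_uncurry_energy mod).comp measurable_prodMk_left

theorem map_energy_stdNormal (mod : EnergyModel) (θ : ℝ) :
    stdNormal.map (h.energy mod θ) = h.energyLaw mod θ := by
  have key : gaussianReal (-θ) (h.noise ^ 2) = stdNormal.map (fun z => -θ - h.noise * z) := by
    rw [gaussianReal_eq_map_stdNormal (-θ) (h.noise ^ 2) (-h.noise) (by push_cast; ring)]
    congr 1; ext z; ring
  cases mod
  · exact key.symm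
  · exact key.symm
  · simp only [energyLaw, logGaussianReal]
    rw [gaussianReal_eq_map_stdNormal _ _ _ (Real.sq_sqrt h.logNoiseVar.2),
      Measure.map_map (by fun_prop) (by fun_prop)]
    rfl

/-- The sign change or the logarithm and shift in `update` undoes the one in `energy`. All models
thereby become one: a Gaussian parameter observed with Gaussian noise. -/
theorem update_energy_decode (mod : EnergyModel) (q : ℝ × ℝ≥0) (y z : ℝ) :
    h.update mod q (h.energy mod (decode mod y) z) =
      gaussianUpdate (h.obsVar mod) q (y + √(h.obsVar mod : ℝ) * z) := by
  cases mod
  · simp [update, energy, decode, obsVar, add_comm]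
  · simp [update, energy, decode, obsVar, add_comm]
  · simp only [update, energy, decode, obsVar, neg_neg, Real.log_exp]
    congr 1; ring

/-- The posterior parameters as a function of the standardized Gaussian observation. -/
def posterior (u : ℝ≥0) (q : ℝ × ℝ≥0) (b : ℝ) : ℝ × ℝ≥0 :=
  (q.1 + q.2 / √((q.2 : ℝ) + u) * b, (1 / q.2 + 1 / u)⁻¹)

theorem posterior_var {u v : ℝ≥0} (hu : 0 < u) (hv : 0 < v) (m b : ℝ) :
    ((posterior u (m, v) b).2 : ℝ) = v * u / (v + u) := by
  have hu' : (0 : ℝ) < u := hu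
  have hv' : (0 : ℝ) < v := hv
  simp only [posterior]; push_cast; field_simp; ring

/-- The predictive law of the observation is N(m, v + u), so `b` is its standardized value. -/
theorem gaussianUpdate_standardized {u : ℝ≥0} {q : ℝ × ℝ≥0} (hu : 0 < u) (hq : 0 < q.2) (b : ℝ) :
    gaussianUpdate u q (q.1 + √((q.2 : ℝ) + u) * b) = posterior u q b := by
  obtain ⟨m, v⟩ := q
  have hu' : (0 : ℝ) < u := hu
  have hv' : (0 : ℝ) < v := hq
  have hs : √((v : ℝ) + u) ^ 2 = v + u := Real.sq_sqrt (by positivity)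
  have hs0 : 0 < √((v : ℝ) + u) := Real.sqrt_pos.2 (by positivity)
  simp only [gaussianUpdate, posterior]
  ext
  · push_cast
    have hne : (v : ℝ) + u ≠ 0 := by positivity
    have e : v / √((v : ℝ) + u) = v * √((v : ℝ) + u) / (v + u) := by
      rw [div_eq_div_iff hs0.ne' hne]; linear_combination (-(v : ℝ)) * hs
    rw [e]; field_simp; ring
  · rfl

/-- The Gaussian pair of prior and noise is a rotation of the pair of posterior and observation. -/
theorem exists_angle_posterior {u : ℝ≥0} {q : ℝ × ℝ≥0} (hu : 0 < u) (hq : 0 < q.2) :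
    ∃ φ : ℝ, ∀ w b : ℝ,
      gaussianUpdate u q (q.1 + √(q.2 : ℝ) * (Real.cos φ * w + Real.sin φ * b) +
          √(u : ℝ) * (-Real.sin φ * w + Real.cos φ * b)) = posterior u q b ∧
      q.1 + √(q.2 : ℝ) * (Real.cos φ * w + Real.sin φ * b) =
        (posterior u q b).1 + √((posterior u q b).2 : ℝ) * w := by
  obtain ⟨m, v⟩ := q
  have hu' : (0 : ℝ) < u := hu
  have hv' : (0 : ℝ) < v := hq
  set S := √((v : ℝ) + u) with hS
  have hs : S ^ 2 = v + u := Real.sq_sqrt (by positivity)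
  have hs0 : 0 < S := Real.sqrt_pos.2 (by positivity)
  have hv2 : √(v : ℝ) ^ 2 = v := Real.sq_sqrt hv'.le
  have hu2 : √(u : ℝ) ^ 2 = u := Real.sq_sqrt hu'.le
  have hv0 : 0 < √(v : ℝ) := Real.sqrt_pos.2 hv'
  have hu0 : 0 < √(u : ℝ) := Real.sqrt_pos.2 hu'
  -- With sine √v / S and cosine √u / S, the combination √v a + √u z equals S b. The observation
  -- then depends on `b` alone, and `w` is the independent residual.
  have hsin : Real.sin (Real.arcsin (√(v : ℝ) / S)) = √(v : ℝ) / S := by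
    refine Real.sin_arcsin ((by norm_num : (-1 : ℝ) ≤ 0).trans (by positivity)) ?_
    rw [div_le_one hs0]
    exact Real.sqrt_le_sqrt (by linarith)
  have hcos : Real.cos (Real.arcsin (√(v : ℝ) / S)) = √(u : ℝ) / S := by
    rw [Real.cos_arcsin, Real.sqrt_eq_iff_mul_self_eq_of_pos (by positivity)]
    field_simp; rw [hu2, hs, hv2]; ring
  refine ⟨Real.arcsin (√(v : ℝ) / S), fun w b => ?_⟩
  rw [hsin, hcos]
  constructor
  · rw [← gaussianUpdate_standardized hu hq]
    congr 1
    simp only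
    rw [← hS]
    field_simp
    linear_combination b * hv2 + b * hu2 - b * hs
  · have : √((posterior u (m, v) b).2 : ℝ) = √(v : ℝ) * √(u : ℝ) / S := by
      rw [posterior_var hu hq, Real.sqrt_div (by positivity), Real.sqrt_mul hv'.le]
    rw [this]
    simp only [posterior]
    rw [← hS]
    field_simp
    linear_combination b * hv2

theorem measurable_posterior (u : ℝ≥0) (q : ℝ × ℝ≥0) : Measurable (posterior u q) := by
  unfold posterior; fun_prop

theorem measurable_uncurry_update (mod : EnergyModel) :
    Measurable fun z : (ℝ × ℝ≥0) × ℝ => h.update mod z.1 z.2 := by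
  cases mod <;> simp only [update, gaussianUpdate] <;> fun_prop

end EdgeHyper

/-! ### Second moments of the weight fluctuations -/

theorem integral_exp_mul_stdNormal (c : ℝ) : ∫ a, Real.exp (c * a) ∂stdNormal = Real.exp (c ^ 2 / 2) := by
  have h := congrFun (mgf_id_gaussianReal (μ := 0) (v := 1)) c
  simp only [mgf, id] at h
  rw [h]; congr 1; push_cast; ring

theorem integrable_exp_mul_stdNormal (c : ℝ) :
    Integrable (fun a => Real.exp (c * a)) stdNormal :=
  integrable_exp_mul_gaussianReal c

theorem lintegral_exp_add_mul_stdNormal (m c : ℝ) :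
    ∫⁻ a, ENNReal.ofReal (Real.exp (m + c * a)) ∂stdNormal =
      ENNReal.ofReal (Real.exp (m + c ^ 2 / 2)) := by
  simp_rw [Real.exp_add]
  rw [← ofReal_integral_eq_lintegral_ofReal ((integrable_exp_mul_stdNormal c).const_mul _)
    (ae_of_all _ fun a => by positivity), integral_const_mul, integral_exp_mul_stdNormal]

theorem integral_sq_stdNormal : ∫ a, a ^ 2 ∂stdNormal = 1 := by
  have h := variance_fun_id_gaussianReal (μ := 0) (v := 1)
  rw [variance_eq_integral (by fun_prop), integral_id_gaussianReal] at h
  simpa using h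

theorem lintegral_sq_stdNormal : ∫⁻ a, ENNReal.ofReal (a ^ 2) ∂stdNormal = 1 := by
  have hi : Integrable (fun a : ℝ => a ^ 2) stdNormal :=
    (memLp_id_gaussianReal (μ := 0) (v := 1) 2).integrable_sq
  rw [← ofReal_integral_eq_lintegral_ofReal hi (ae_of_all _ fun a => by positivity),
    integral_sq_stdNormal, ENNReal.ofReal_one]

/-- The ratio of the second moment of the weight fluctuations of an edge and its variance
parameter, up to a constant. -/
def fluctuation : EnergyModel → ℝ × ℝ≥0 → ℝ≥0∞
  | .gaussian, _ => 4
  | .rectifiedGaussian, _ => 4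
  | .logGaussian, q => 2 * ENNReal.ofReal (Real.exp (2 * q.1 + 2 * q.2))

theorem measurable_fluctuation (mod : EnergyModel) : Measurable (fluctuation mod) := by
  cases mod
  · exact measurable_const
  · exact measurable_const
  · change Measurable fun q : ℝ × ℝ≥0 => 2 * ENNReal.ofReal (Real.exp (2 * q.1 + 2 * q.2))
    fun_prop

namespace EdgeHyper

variable (h : EdgeHyper)

theorem weight_gaussian (θ : ℝ) : h.weight .gaussian θ = -θ := integral_id_gaussianReal

theorem weight_rectifiedGaussian (θ : ℝ) :
    h.weight .rectifiedGaussian θ = ∫ z, max 0 (-θ - h.noise * z) ∂stdNormal := by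
  simp only [weight]
  rw [← map_energy_stdNormal, integral_map (h.measurable_energy _ _).aemeasurable
    (by fun_prop)]
  rfl

/-- The form exp (log (-θ)) is kept because it holds for every real θ, whereas -θ would need θ < 0.
-/
theorem weight_logGaussian (θ : ℝ) : h.weight .logGaussian θ = Real.exp (Real.log (-θ)) := by
  simp only [weight]
  rw [← map_energy_stdNormal, integral_map (h.measurable_energy _ _).aemeasurable
    (by fun_prop)]
  simp only [energy, Real.exp_add]
  rw [integral_const_mul, integral_exp_mul_stdNormal, ← Real.exp_add, Real.sq_sqrt h.logNoiseVar.coe_nonneg]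
  congr 1; ring

/-- Rectification is 1-Lipschitz, and both expectations can use the same noise variable. -/
theorem abs_weight_rectifiedGaussian_sub_le (θ θ' : ℝ) :
    |h.weight .rectifiedGaussian θ - h.weight .rectifiedGaussian θ'| ≤ |θ - θ'| := by
  have hz : Integrable (fun z : ℝ => z) stdNormal :=
    (memLp_id_gaussianReal (μ := 0) (v := 1) 1).integrable (by simp)
  have hi : ∀ θ : ℝ, Integrable (fun z => max 0 (-θ - h.noise * z)) stdNormal := fun θ =>
    (integrable_const 0).sup ((integrable_const (-θ)).sub (hz.const_mul _))
  rw [weight_rectifiedGaussian, weight_rectifiedGaussian, ← integral_sub (hi θ) (hi θ')]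
  have hle : ∀ z, ‖max 0 (-θ - h.noise * z) - max 0 (-θ' - h.noise * z)‖ ≤ |θ - θ'| := fun z => by
    rw [Real.norm_eq_abs, max_comm 0, max_comm 0]
    refine (abs_max_sub_max_le_abs _ _ _).trans_eq ?_
    rw [← abs_neg]; congr 1; ring
  simpa using norm_integral_le_of_norm_le_const (μ := stdNormal) (ae_of_all _ hle)

theorem measurable_weight (mod : EnergyModel) : Measurable (h.weight mod) := by
  cases mod
  · simp_rw [funext h.weight_gaussian]; fun_prop
  · refine LipschitzWith.continuous (K := 1) (LipschitzWith.of_dist_le_mul fun x y => ?_) |>.measurable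
    simpa [Real.dist_eq] using h.abs_weight_rectifiedGaussian_sub_le x y
  · simp_rw [funext h.weight_logGaussian]; fun_prop

theorem lintegral_sq_sub_stdNormal_le (m c : ℝ) :
    ∫⁻ a, ∫⁻ a', ENNReal.ofReal (((m + c * a) - (m + c * a')) ^ 2) ∂stdNormal ∂stdNormal ≤
      ENNReal.ofReal (c ^ 2) * 4 := by
  calc _ ≤ ∫⁻ a, ∫⁻ a', ENNReal.ofReal (2 * c ^ 2) * ENNReal.ofReal (a ^ 2) +
        ENNReal.ofReal (2 * c ^ 2) * ENNReal.ofReal (a' ^ 2) ∂stdNormal ∂stdNormal := by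
        refine lintegral_mono fun a => lintegral_mono fun a' => ?_
        dsimp only
        rw [← ENNReal.ofReal_mul (by positivity), ← ENNReal.ofReal_mul (by positivity),
          ← ENNReal.ofReal_add (by positivity) (by positivity)]
        refine ENNReal.ofReal_le_ofReal ?_
        nlinarith [sq_nonneg (c * a + c * a')]
    _ = ENNReal.ofReal (2 * c ^ 2) + ENNReal.ofReal (2 * c ^ 2) := by
        simp_rw [lintegral_add_left measurable_const,
          lintegral_const_mul' _ _ ENNReal.ofReal_ne_top, lintegral_sq_stdNormal]
        rw [lintegral_add_right _ measurable_const, lintegral_const, lintegral_const_mul' _ _ ENNReal.ofReal_ne_top]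
        simp [lintegral_const, lintegral_sq_stdNormal]
    _ = _ := by
        rw [← ENNReal.ofReal_add (by positivity) (by positivity),
          show (4 : ℝ≥0∞) = ENNReal.ofReal 4 by simp, ← ENNReal.ofReal_mul (by positivity)]
        congr 1; ring

/-- The exact value is 2 exp(2m) (exp(2v) - exp(v)), and 1 - exp(-v) ≤ v extracts the factor v. -/
theorem lintegral_sq_exp_sub_stdNormal_le (m : ℝ) (v : ℝ≥0) :
    ∫⁻ a, ∫⁻ a', ENNReal.ofReal ((Real.exp (m + √(v : ℝ) * a) - Real.exp (m + √(v : ℝ) * a')) ^ 2)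
      ∂stdNormal ∂stdNormal ≤ v * (2 * ENNReal.ofReal (Real.exp (2 * m + 2 * v))) := by
  set c := √(v : ℝ)
  have hc : c ^ 2 = v := Real.sq_sqrt v.coe_nonneg
  have e : ∀ a a' : ℝ, (Real.exp (m + c * a) - Real.exp (m + c * a')) ^ 2 =
      Real.exp (2 * m) * (Real.exp ((2 * c) * a) + Real.exp ((2 * c) * a') -
        2 * Real.exp (c * a) * Real.exp (c * a')) := fun a a' => by
    have h2 : ∀ x, Real.exp (2 * x) = Real.exp x ^ 2 := fun x => by rw [two_mul, Real.exp_add, sq]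
    rw [mul_assoc 2 c a, mul_assoc 2 c a', h2, h2, h2, Real.exp_add, Real.exp_add]; ring
  have hi1 : ∀ k, Integrable (fun a => Real.exp (k * a)) stdNormal := integrable_exp_mul_stdNormal
  have hin : ∀ a, ∫⁻ a', ENNReal.ofReal ((Real.exp (m + c * a) - Real.exp (m + c * a')) ^ 2)
      ∂stdNormal = ENNReal.ofReal (Real.exp (2 * m) * (Real.exp ((2 * c) * a) +
        Real.exp (2 * v) - 2 * Real.exp (c * a) * Real.exp (v / 2))) := fun a => by
    rw [← ofReal_integral_eq_lintegral_ofReal _ (ae_of_all _ fun a' => sq_nonneg _)]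
    · simp_rw [e]
      rw [integral_const_mul, integral_sub (by fun_prop) (by fun_prop),
        integral_add (by fun_prop) (by fun_prop), integral_const_mul, integral_exp_mul_stdNormal,
        integral_exp_mul_stdNormal, hc, mul_pow, hc]
      simp only [integral_const, probReal_univ, smul_eq_mul, one_mul]
      ring_nf
    · simp_rw [e]; fun_prop
  simp_rw [hin]
  have hexp : Real.exp (2 * v) = Real.exp v * Real.exp v := by rw [two_mul, Real.exp_add]
  have h1 : (1 : ℝ) ≤ Real.exp v := Real.one_le_exp v.coe_nonneg
  rw [← ofReal_integral_eq_lintegral_ofReal (by fun_prop) (ae_of_all _ fun a => ?_)]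
  · rw [integral_const_mul, integral_sub (by fun_prop) (by fun_prop),
      integral_add (by fun_prop) (by fun_prop), integral_mul_const, integral_const_mul,
      integral_exp_mul_stdNormal, integral_exp_mul_stdNormal, mul_pow, hc]
    rw [← ENNReal.ofReal_coe_nnreal, show (2 : ℝ≥0∞) = ENNReal.ofReal 2 by simp,
      ← ENNReal.ofReal_mul (by positivity), ← ENNReal.ofReal_mul (by positivity)]
    refine ENNReal.ofReal_le_ofReal ?_
    simp only [integral_const, probReal_univ, smul_eq_mul, one_mul]
    have h3 : Real.exp (2 * v) - Real.exp v ≤ v * Real.exp (2 * v) := by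
      have := Real.add_one_le_exp (-(v : ℝ))
      have h4 : Real.exp v = Real.exp (2 * v) * Real.exp (-v) := by
        rw [← Real.exp_add]; congr 1; ring
      nlinarith [Real.exp_pos (2 * (v : ℝ))]
    have h5 : Real.exp ((v : ℝ) / 2) * Real.exp ((v : ℝ) / 2) = Real.exp v := by
      rw [← Real.exp_add]; congr 1; ring
    have h6 : Real.exp (2 ^ 2 * (v : ℝ) / 2) = Real.exp (2 * v) := by congr 1; ring
    rw [h6, Real.exp_add]
    nlinarith [Real.exp_pos (2 * m), mul_le_mul_of_nonneg_left h3 (Real.exp_pos (2 * m)).le]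
  · have h5 : Real.exp ((v : ℝ) / 2) ^ 2 = Real.exp v := by
      rw [sq, ← Real.exp_add]; congr 1; ring
    have h7 : Real.exp (2 * c * a) = Real.exp (c * a) ^ 2 := by
      rw [sq, ← Real.exp_add]; congr 1; ring
    -- Since exp(2v) ≥ exp(v), the bracket is at least the square of exp(c a) - exp(v / 2).
    refine mul_nonneg (Real.exp_pos _).le ?_
    rw [h7, hexp]
    nlinarith [sq_nonneg (Real.exp (c * a) - Real.exp ((v : ℝ) / 2))]

theorem lintegral_sq_weight_sub_le (mod : EnergyModel) (q : ℝ × ℝ≥0) :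
    ∫⁻ a, ∫⁻ a', ENNReal.ofReal ((h.weight mod (draw mod q a) - h.weight mod (draw mod q a')) ^ 2)
      ∂stdNormal ∂stdNormal ≤ q.2 * fluctuation mod q := by
  have hg := lintegral_sq_sub_stdNormal_le q.1 (√(q.2 : ℝ))
  rw [Real.sq_sqrt q.2.coe_nonneg, ENNReal.ofReal_coe_nnreal] at hg
  cases mod
  · refine le_trans (lintegral_mono fun a => lintegral_mono fun a' => ?_) hg
    simp only [weight_gaussian, draw, decode]
    refine ENNReal.ofReal_le_ofReal (le_of_eq ?_)
    ring
  · refine le_trans (lintegral_mono fun a => lintegral_mono fun a' => ?_) hg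
    exact ENNReal.ofReal_le_ofReal (sq_le_sq.2 (h.abs_weight_rectifiedGaussian_sub_le _ _))
  · simpa only [weight_logGaussian, fluctuation, draw, decode, neg_neg, Real.log_exp] using
      lintegral_sq_exp_sub_stdNormal_le q.1 q.2

/-- In the log-Gaussian model the posterior mean has variance v² / (v + u) = v - v', where v' is the
posterior variance. Averaging exp(2m' + 2v') therefore gives exp(2m + 2(v - v') + 2v') = exp(2m +
2v). -/
theorem lintegral_fluctuation_posterior (mod : EnergyModel) {u : ℝ≥0} {q : ℝ × ℝ≥0} (hu : 0 < u)
    (hq : 0 < q.2) :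
    ∫⁻ b, fluctuation mod (posterior u q b) ∂stdNormal = fluctuation mod q := by
  cases mod
  · simp [fluctuation]
  · simp [fluctuation]
  · obtain ⟨m, v⟩ := q
    have hu' : (0 : ℝ) < u := hu
    have hv' : (0 : ℝ) < v := hq
    simp only [fluctuation]
    rw [lintegral_const_mul' _ _ (by simp)]
    simp_rw [posterior_var hu hq]
    have e : ∀ b, 2 * (posterior u (m, v) b).1 + 2 * (v * u / (v + u) : ℝ) =
        (2 * m + 2 * (v * u / (v + u) : ℝ)) + (2 * (v / √((v : ℝ) + u))) * b := fun b => by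
      simp only [posterior]; ring
    simp_rw [e, lintegral_exp_add_mul_stdNormal]
    congr 3
    rw [mul_pow, div_pow, Real.sq_sqrt (by positivity)]
    field_simp; ring

/-! ### Bounds uniform in the hyper-parameters -/

/-- The unit of length of the edge: its weights are of this order, up to constants that depend on
the bound `M` of the hyper-parameters only. -/
def scale : EnergyModel → ℝ≥0
  | .gaussian => 1
  | .rectifiedGaussian => 1
  | .logGaussian => (-h.mean).toNNReal

theorem logVar_bounds {μ x : ℝ} (hμ : μ < 0) (hx : 0 < x) :
    0 < Real.log (1 + x ^ 2 / μ ^ 2) ∧ Real.log (1 + x ^ 2 / μ ^ 2) * μ ^ 2 ≤ x ^ 2 := by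
  have hμ2 : 0 < μ ^ 2 := sq_pos_of_neg hμ
  have h0 : 0 < x ^ 2 / μ ^ 2 := by positivity
  refine ⟨Real.log_pos (by linarith), ?_⟩
  have := Real.log_le_sub_one_of_pos (show 0 < 1 + x ^ 2 / μ ^ 2 by linarith)
  rw [← le_div_iff₀ hμ2]; linarith

/-- In the log-Gaussian model the noise variance ℓ is not bounded as μ tends to 0, but ℓ μ² ≤ σ² ≤
M²; likewise L μ² ≤ ς² ≤ M² μ² ≤ M⁴. The prior fluctuation equals 2 (μ² + ς²). The constant M² + M⁴
serves all models at once. -/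
theorem BoundedBy.prior_bounds {h : EdgeHyper} {M : ℝ} {mod : EnergyModel} (hb : h.BoundedBy M mod) :
    0 < h.scale mod ∧ 0 < (h.prior mod).2 ∧ 0 < h.obsVar mod ∧
      ((h.prior mod).2 : ℝ) * (h.scale mod : ℝ) ^ 2 ≤ M ^ 2 + M ^ 4 ∧
      (h.obsVar mod : ℝ) * (h.scale mod : ℝ) ^ 2 ≤ M ^ 2 + M ^ 4 ∧
      fluctuation mod (h.prior mod) ≤ ENNReal.ofReal (4 * (1 + M ^ 2) * (h.scale mod : ℝ) ^ 2) := by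
  have hg : 0 < h.sd → 0 < h.noise → (h.sd : ℝ) ≤ M → (h.noise : ℝ) ≤ M →
      0 < (1 : ℝ≥0) ∧ 0 < h.sd ^ 2 ∧ 0 < h.noise ^ 2 ∧
      ((h.sd ^ 2 : ℝ≥0) : ℝ) * ((1 : ℝ≥0) : ℝ) ^ 2 ≤ M ^ 2 + M ^ 4 ∧
      ((h.noise ^ 2 : ℝ≥0) : ℝ) * ((1 : ℝ≥0) : ℝ) ^ 2 ≤ M ^ 2 + M ^ 4 ∧
      (4 : ℝ≥0∞) ≤ ENNReal.ofReal (4 * (1 + M ^ 2) * ((1 : ℝ≥0) : ℝ) ^ 2) := by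
    intro h1 h2 h3 h4
    have h5 := h.sd.coe_nonneg
    have h6 := h.noise.coe_nonneg
    refine ⟨one_pos, by positivity, by positivity, ?_, ?_, ?_⟩
    · push_cast; nlinarith [sq_nonneg (M ^ 2)]
    · push_cast; nlinarith [sq_nonneg (M ^ 2)]
    · rw [show (4 : ℝ≥0∞) = ENNReal.ofReal 4 by simp]
      refine ENNReal.ofReal_le_ofReal ?_
      simp; nlinarith [sq_nonneg M]
  cases mod
  · exact hg hb.1 hb.2.1 hb.2.2.1 hb.2.2.2
  · exact hg hb.1 hb.2.1 hb.2.2.1 hb.2.2.2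
  · obtain ⟨h1, h2, h3, h4, h5, h6⟩ := hb
    obtain ⟨h7, h8⟩ := logVar_bounds h3 (NNReal.coe_pos.2 h1)
    obtain ⟨h9, h10⟩ := logVar_bounds h3 (NNReal.coe_pos.2 h2)
    have hsc : (h.scale .logGaussian : ℝ) = -h.mean := Real.coe_toNNReal _ (by linarith)
    have hL : (h.logPriorVar : ℝ) = _ := Real.coe_toNNReal _ h7.le
    have hl : (h.logNoiseVar : ℝ) = _ := Real.coe_toNNReal _ h9.le
    have hM : 0 < M := by linarith
    have h11 := h.sd.coe_nonneg
    have h12 := h.noise.coe_nonneg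
    have hsd : (h.sd : ℝ) ^ 2 ≤ M ^ 2 * h.mean ^ 2 := by nlinarith
    have hmean : h.mean ^ 2 ≤ M ^ 2 := by nlinarith
    refine ⟨Real.toNNReal_pos.2 (by linarith), Real.toNNReal_pos.2 h7, Real.toNNReal_pos.2 h9,
      ?_, ?_, ?_⟩
    · simp only [prior, hsc, hL, neg_sq]
      nlinarith [mul_le_mul_of_nonneg_left hmean (sq_nonneg M), sq_nonneg M]
    · simp only [obsVar, hsc, hl, neg_sq]
      nlinarith [sq_nonneg (M ^ 2)]
    · have hμ2 : 0 < h.mean ^ 2 := by nlinarith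
      simp only [fluctuation, prior, hsc, neg_sq]
      rw [show (2 : ℝ≥0∞) = ENNReal.ofReal 2 by simp, ← ENNReal.ofReal_mul (by positivity)]
      refine ENNReal.ofReal_le_ofReal ?_
      have e : 2 * (Real.log (-h.mean) - (h.logPriorVar : ℝ) / 2) + 2 * h.logPriorVar =
          Real.log (-h.mean) + Real.log (-h.mean) + h.logPriorVar := by ring
      rw [e, Real.exp_add, Real.exp_add, Real.exp_log (by linarith), hL,
        Real.exp_log (by positivity)]
      have : -h.mean * -h.mean * (1 + (h.sd : ℝ) ^ 2 / h.mean ^ 2) = h.mean ^ 2 + h.sd ^ 2 := by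
        have := hμ2.ne'
        rw [neg_mul_neg, ← sq, mul_add, mul_one, mul_div_cancel₀ _ this]
      rw [this]
      nlinarith [mul_nonneg (sq_nonneg M) hμ2.le]

end EdgeHyper

/-! ### Rotation invariance of independent normal pairs -/

/-- The law of a family of independent standard normal variables. -/
abbrev stdNormals (ι : Type*) [Fintype ι] : Measure (ι → ℝ) := Measure.pi fun _ => stdNormal

theorem lintegral_stdNormals_eval {ι : Type*} [Fintype ι] (e : ι) {f : ℝ → ℝ≥0∞}
    (hf : Measurable f) : ∫⁻ b, f (b e) ∂stdNormals ι = ∫⁻ b, f b ∂stdNormal :=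
  (measurePreserving_eval (fun _ : ι => stdNormal) e).lintegral_comp hf

/-- A centred product Gaussian on the plane is rotation invariant; each coordinate pair is rotated
by its own angle. -/
theorem lintegral_lintegral_stdNormals_rotation {ι : Type*} [Fintype ι] (φ : ι → ℝ)
    {F : (ι → ℝ) → (ι → ℝ) → ℝ≥0∞} (hF : Measurable (Function.uncurry F)) :
    ∫⁻ a, ∫⁻ z, F a z ∂stdNormals ι ∂stdNormals ι =
      ∫⁻ b, ∫⁻ w, F (fun e => Real.cos (φ e) * w e + Real.sin (φ e) * b e)
        (fun e => -Real.sin (φ e) * w e + Real.cos (φ e) * b e) ∂stdNormals ι ∂stdNormals ι := by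
  have hrot : ∀ e, MeasurePreserving (ContinuousLinearMap.rotation (φ e) : ℝ × ℝ →L[ℝ] ℝ × ℝ)
      (stdNormal.prod stdNormal) (stdNormal.prod stdNormal) := fun e =>
    ⟨by fun_prop, IsGaussian.map_rotation_eq_self (by simp) _⟩
  have hpi := measurePreserving_pi (fun _ : ι => stdNormal.prod stdNormal)
    (fun _ => stdNormal.prod stdNormal) hrot
  have harr := measurePreserving_arrowProdEquivProdArrow ℝ ℝ ι (fun _ => stdNormal)
    (fun _ => stdNormal)
  set G : (ι → ℝ) → (ι → ℝ) → ℝ≥0∞ := fun w b =>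
    F (fun e => Real.cos (φ e) * w e + Real.sin (φ e) * b e)
      (fun e => -Real.sin (φ e) * w e + Real.cos (φ e) * b e)
  have hG : Measurable (Function.uncurry G) :=
    hF.comp (by fun_prop : Measurable fun y : (ι → ℝ) × (ι → ℝ) =>
      ((fun e => Real.cos (φ e) * y.1 e + Real.sin (φ e) * y.2 e),
        fun e => -Real.sin (φ e) * y.1 e + Real.cos (φ e) * y.2 e))
  change _ = ∫⁻ b, ∫⁻ w, G w b ∂stdNormals ι ∂stdNormals ι
  rw [← lintegral_lintegral_swap hG.aemeasurable, lintegral_lintegral hF.aemeasurable,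
    lintegral_lintegral hG.aemeasurable]
  change ∫⁻ y, Function.uncurry F y ∂_ = ∫⁻ y, Function.uncurry G y ∂_
  rw [← harr.lintegral_comp hF, ← harr.lintegral_comp hG,
    
    ← hpi.lintegral_comp (f := fun y => Function.uncurry F (MeasurableEquiv.arrowProdEquivProdArrow
      ℝ ℝ ι y)) (hF.comp (MeasurableEquiv.measurable _))]
  rfl

/-! ### Measurability and the recursion for the regret -/

section Regret

variable {V : Type*} {E : Finset (V × V)} {s t : V} (mod : EnergyModel) (h : E → EdgeHyper)

/-- Mean rewards with the laws `belief mod (p e)`, as functions of standard normal variables. -/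
def drawAll (p : E → ℝ × ℝ≥0) (a : E → ℝ) : E → ℝ := fun e => draw mod (p e) (a e)

/-- Energies with the laws `energyLaw mod (θ e)`, as functions of standard normal variables. -/
def energyAll (θ z : E → ℝ) : E → ℝ := fun e => (h e).energy mod (θ e) (z e)

theorem measurable_uncurry_drawAll :
    Measurable fun y : (E → ℝ × ℝ≥0) × (E → ℝ) => drawAll mod y.1 y.2 :=
  measurable_pi_lambda _ fun e => (measurable_uncurry_draw mod).comp
    (by fun_prop : Measurable fun y : (E → ℝ × ℝ≥0) × (E → ℝ) => (y.1 e, y.2 e))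

theorem measurable_drawAll (p : E → ℝ × ℝ≥0) : Measurable (drawAll mod p) :=
  (measurable_uncurry_drawAll mod).comp measurable_prodMk_left

theorem measurable_uncurry_energyAll :
    Measurable fun y : (E → ℝ) × (E → ℝ) => energyAll mod h y.1 y.2 :=
  measurable_pi_lambda _ fun e => ((h e).measurable_uncurry_energy mod).comp
    (by fun_prop : Measurable fun y : (E → ℝ) × (E → ℝ) => (y.1 e, y.2 e))

theorem measurable_energyAll (θ : E → ℝ) : Measurable (energyAll mod h θ) :=
  (measurable_uncurry_energyAll mod h).comp measurable_prodMk_left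

theorem pi_belief_eq_map (p : E → ℝ × ℝ≥0) :
    (Measure.pi fun e => belief mod (p e)) = (stdNormals E).map (drawAll mod p) := by
  have : ∀ e, IsProbabilityMeasure (stdNormal.map (draw mod (p e))) := fun e =>
    Measure.isProbabilityMeasure_map (measurable_draw mod _).aemeasurable
  simp_rw [← map_draw_stdNormal]
  exact (Measure.pi_map_pi fun e => (measurable_draw mod (p e)).aemeasurable).symm

theorem pi_energyLaw_eq_map (θ : E → ℝ) :
    (Measure.pi fun e => (h e).energyLaw mod (θ e)) = (stdNormals E).map (energyAll mod h θ) := by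
  have : ∀ e, IsProbabilityMeasure (stdNormal.map ((h e).energy mod (θ e))) := fun e =>
    Measure.isProbabilityMeasure_map ((h e).measurable_energy mod _).aemeasurable
  simp_rw [← EdgeHyper.map_energy_stdNormal]
  exact (Measure.pi_map_pi fun e => ((h e).measurable_energy mod (θ e)).aemeasurable).symm

theorem measurable_weights : Measurable (weights mod h) :=
  measurable_pi_lambda _ fun e => ((h e).measurable_weight mod).comp (measurable_pi_apply e)

variable [DecidableEq V] (sol : ShortestPathSolver E s t)

/-- A function of the played arm and of further data is jointly measurable if it is measurable
for each arm. -/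
theorem ShortestPathSolver.measurable_comp_arm {α β : Type*} [MeasurableSpace α]
    [MeasurableSpace β] {w : α → E → ℝ} (hw : Measurable w) {f : Finset E → α → β}
    (hf : ∀ a, Measurable (f a)) : Measurable fun x => f (sol.arm (w x)) x := by
  let _ : MeasurableSpace (Finset E) := ⊤
  have harm : Measurable sol.arm := measurable_to_countable' fun a => sol.measurableSet_arm a
  have hf' : Measurable (Function.uncurry f) := measurable_from_prod_countable_right hf
  exact hf'.comp ((harm.comp hw).prodMk measurable_id)

/-- The arm played when the standard normal variables of the sampling step are `a`. -/
def playedArm (p : E → ℝ × ℝ≥0) (a : E → ℝ) : Finset E :=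
  sol.arm (weights mod h (drawAll mod p a))

theorem measurable_comp_playedArm {α β : Type*} [MeasurableSpace α] [MeasurableSpace β]
    {p : α → E → ℝ × ℝ≥0} {a : α → E → ℝ} (hp : Measurable p) (ha : Measurable a)
    {f : Finset E → α → β} (hf : ∀ b, Measurable (f b)) :
    Measurable fun x => f (playedArm mod h sol (p x) (a x)) x :=
  sol.measurable_comp_arm
    ((measurable_weights mod h).comp ((measurable_uncurry_drawAll mod).comp (hp.prodMk ha))) hf

theorem measurable_gap (b : Finset E) : Measurable fun θ => gap mod h sol θ b := by
  unfold gap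
  have hw := measurable_weights mod h
  have hsum : ∀ c : Finset E, Measurable fun θ => ∑ e ∈ c, weights mod h θ e := fun c =>
    Finset.measurable_sum _ fun e _ => (measurable_pi_apply e).comp hw
  exact (hsum b).sub (sol.measurable_comp_arm hw (f := fun c θ => ∑ e ∈ c, weights mod h θ e) hsum)

theorem measurable_updateParameters (b : Finset E) :
    Measurable fun y : (E → ℝ × ℝ≥0) × (E → ℝ) => updateParameters mod h y.1 b y.2 := by
  refine measurable_pi_lambda _ fun e => ?_
  simp only [updateParameters]
  split_ifs
  · exact ((h e).measurable_uncurry_update mod).comp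
      (by fun_prop : Measurable fun y : (E → ℝ × ℝ≥0) × (E → ℝ) => (y.1 e, y.2 e))
  · fun_prop

theorem measurable_lintegral_update {G : (E → ℝ) → (E → ℝ × ℝ≥0) → ℝ≥0∞}
    (hG : Measurable (Function.uncurry G)) (b : Finset E) :
    Measurable fun y : (E → ℝ) × (E → ℝ × ℝ≥0) =>
      ∫⁻ z, G y.1 (updateParameters mod h y.2 b (energyAll mod h y.1 z)) ∂stdNormals E := by
  have hx : Measurable fun y : ((E → ℝ) × (E → ℝ × ℝ≥0)) × (E → ℝ) =>
      energyAll mod h y.1.1 y.2 :=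
    (measurable_uncurry_energyAll mod h).comp
      ((measurable_fst.comp measurable_fst).prodMk measurable_snd)
  have hupd : Measurable fun y : ((E → ℝ) × (E → ℝ × ℝ≥0)) × (E → ℝ) =>
      updateParameters mod h y.1.2 b (energyAll mod h y.1.1 y.2) :=
    (measurable_updateParameters mod h b).comp ((measurable_snd.comp measurable_fst).prodMk hx)
  exact (hG.comp ((measurable_fst.comp measurable_fst).prodMk hupd)).lintegral_prod_right'

/-- Measurability for `n` is a hypothesis here because measurability for `n + 1` is itself derived
from this formula. -/
theorem expectedRegret_succ_of_measurable {n : ℕ}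
    (hn : Measurable (Function.uncurry fun θ p => expectedRegret mod h sol θ n p))
    (θ : E → ℝ) (p : E → ℝ × ℝ≥0) :
    expectedRegret mod h sol θ (n + 1) p =
      ∫⁻ a, (ENNReal.ofReal (gap mod h sol θ (playedArm mod h sol p a)) +
        ∫⁻ z, expectedRegret mod h sol θ n (updateParameters mod h p (playedArm mod h sol p a)
          (energyAll mod h θ z)) ∂stdNormals E) ∂stdNormals E := by
  rw [expectedRegret, pi_belief_eq_map, lintegral_map _ (measurable_drawAll mod p)]
  · refine lintegral_congr fun a => ?_
    have hm : ∀ b, Measurable fun x => expectedRegret mod h sol θ n (updateParameters mod h p b x) :=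
      fun b => hn.comp (measurable_const.prodMk
        ((measurable_updateParameters mod h b).comp measurable_prodMk_left))
    rw [lintegral_add_left measurable_const, pi_energyLaw_eq_map,
      lintegral_map (hm _) (measurable_energyAll mod h θ), lintegral_const]
    have : IsProbabilityMeasure ((stdNormals E).map (energyAll mod h θ)) :=
      Measure.isProbabilityMeasure_map (measurable_energyAll mod h θ).aemeasurable
    rw [measure_univ, mul_one]
    rfl
  · exact sol.measurable_comp_arm (measurable_weights mod h)
      (f := fun b _ => ∫⁻ x, (ENNReal.ofReal (gap mod h sol θ b) +
        expectedRegret mod h sol θ n (updateParameters mod h p b x))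
        ∂(Measure.pi fun e => (h e).energyLaw mod (θ e))) fun b => measurable_const

theorem measurable_expectedRegret (n : ℕ) :
    Measurable (Function.uncurry fun θ p => expectedRegret mod h sol θ n p) := by
  induction n with
  | zero => exact measurable_const
  | succ n ih =>
    generalize hG : (fun θ p => expectedRegret mod h sol θ n p) = G at ih
    have hG' : ∀ θ p, expectedRegret mod h sol θ n p = G θ p := fun θ p =>
      congrFun (congrFun hG θ) p
    simp_rw [expectedRegret_succ_of_measurable mod h sol (hG ▸ ih), hG']
    have key : Measurable fun x : ((E → ℝ) × (E → ℝ × ℝ≥0)) × (E → ℝ) =>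
        ENNReal.ofReal (gap mod h sol x.1.1 (playedArm mod h sol x.1.2 x.2)) +
          ∫⁻ z, G x.1.1 (updateParameters mod h x.1.2
            (playedArm mod h sol x.1.2 x.2) (energyAll mod h x.1.1 z)) ∂stdNormals E :=
      measurable_comp_playedArm mod h sol (measurable_snd.comp measurable_fst) measurable_snd
        (f := fun b x => ENNReal.ofReal (gap mod h sol x.1.1 b) +
          ∫⁻ z, G x.1.1 (updateParameters mod h x.1.2 b (energyAll mod h x.1.1 z))
            ∂stdNormals E) fun b =>
        ((measurable_gap mod h sol b).comp (measurable_fst.comp measurable_fst)).ennreal_ofReal.add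
          ((measurable_lintegral_update mod h ih b).comp measurable_fst)
    exact key.lintegral_prod_right'

theorem expectedRegret_succ (n : ℕ) (θ : E → ℝ) (p : E → ℝ × ℝ≥0) :
    expectedRegret mod h sol θ (n + 1) p =
      ∫⁻ a, (ENNReal.ofReal (gap mod h sol θ (playedArm mod h sol p a)) +
        ∫⁻ z, expectedRegret mod h sol θ n (updateParameters mod h p (playedArm mod h sol p a)
          (energyAll mod h θ z)) ∂stdNormals E) ∂stdNormals E :=
  expectedRegret_succ_of_measurable mod h sol (measurable_expectedRegret mod h sol n) θ p

/-! ### Bayes' rule as a change of variables -/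

/-- The posterior parameters after the arm `b` was played, as functions of the standardized
observations. -/
def posteriorAll (p : E → ℝ × ℝ≥0) (b : Finset E) (x : E → ℝ) : E → ℝ × ℝ≥0 :=
  fun e => if e ∈ b then EdgeHyper.posterior ((h e).obsVar mod) (p e) (x e) else p e

/-- Drawing θ from the belief and then observing has the same joint law as drawing the observation
and then θ from the resulting posterior. -/
theorem lintegral_lintegral_bayes {p : E → ℝ × ℝ≥0} (hp : ∀ e, 0 < (p e).2)
    (hu : ∀ e, 0 < (h e).obsVar mod) (b : Finset E) {F : (E → ℝ) → (E → ℝ × ℝ≥0) → ℝ≥0∞}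
    (hF : Measurable (Function.uncurry F)) :
    ∫⁻ a, ∫⁻ z, F (drawAll mod p a) (updateParameters mod h p b
        (energyAll mod h (drawAll mod p a) z)) ∂stdNormals E ∂stdNormals E =
      ∫⁻ x, ∫⁻ w, F (drawAll mod (posteriorAll mod h p b x) w) (posteriorAll mod h p b x)
        ∂stdNormals E ∂stdNormals E := by
  choose φ hφ using fun e => EdgeHyper.exists_angle_posterior (hu e) (hp e)
  -- Edges that are not played get the angle 0, so their draw is left alone.
  rw [lintegral_lintegral_stdNormals_rotation (fun e => if e ∈ b then φ e else 0)
    (F := fun a z => F (drawAll mod p a) (updateParameters mod h p b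
        (energyAll mod h (drawAll mod p a) z)))]
  · refine lintegral_congr fun x => lintegral_congr fun w => ?_
    congr 1
    · ext e
      simp only [drawAll, posteriorAll, draw]
      split_ifs with he
      · rw [(hφ e _ _).2]
      · simp
    · ext1 e
      simp only [updateParameters, energyAll, posteriorAll, drawAll, draw]
      split_ifs with he
      · rw [EdgeHyper.update_energy_decode, (hφ e _ _).1]
      · rfl
  · have hd : Measurable fun y : (E → ℝ) × (E → ℝ) => drawAll mod p y.1 :=
      (measurable_drawAll mod p).comp measurable_fst
    have hx := (measurable_uncurry_energyAll mod h).comp (hd.prodMk measurable_snd)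
    exact hF.comp (hd.prodMk ((measurable_updateParameters mod h b).comp
      ((measurable_const (a := p)).prodMk hx)))

/-- The Bayesian regret of `n` further rounds from the posterior parameters `p`. -/
def regretFrom (n : ℕ) (p : E → ℝ × ℝ≥0) : ℝ≥0∞ :=
  ∫⁻ a, expectedRegret mod h sol (drawAll mod p a) n p ∂stdNormals E

theorem bayesRegret_eq_regretFrom (T : ℕ) :
    bayesRegret mod h sol T = regretFrom mod h sol T fun e => (h e).prior mod := by
  rw [bayesRegret, pi_belief_eq_map, lintegral_map _ (measurable_drawAll mod _)]
  · rfl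
  · exact (measurable_expectedRegret mod h sol T).comp measurable_prodMk_right

theorem measurable_gap_playedArm (p : E → ℝ × ℝ≥0) :
    Measurable fun y : (E → ℝ) × (E → ℝ) =>
      gap mod h sol (drawAll mod p y.1) (playedArm mod h sol p y.2) :=
  measurable_comp_playedArm mod h sol measurable_const measurable_snd
    (f := fun b y => gap mod h sol (drawAll mod p y.1) b)
    fun b => (measurable_gap mod h sol b).comp ((measurable_drawAll mod p).comp measurable_fst)

theorem regretFrom_succ {p : E → ℝ × ℝ≥0} (hp : ∀ e, 0 < (p e).2)
    (hu : ∀ e, 0 < (h e).obsVar mod) (n : ℕ) :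
    regretFrom mod h sol (n + 1) p =
      (∫⁻ a, ∫⁻ a', ENNReal.ofReal (gap mod h sol (drawAll mod p a) (playedArm mod h sol p a'))
        ∂stdNormals E ∂stdNormals E) +
      ∫⁻ a', ∫⁻ x, regretFrom mod h sol n (posteriorAll mod h p (playedArm mod h sol p a') x)
        ∂stdNormals E ∂stdNormals E := by
  have hgap := (measurable_gap_playedArm mod h sol p).ennreal_ofReal
  have hm := measurable_expectedRegret mod h sol n
  have hin : ∀ b, Measurable fun y : (E → ℝ) × (E → ℝ) =>
      ∫⁻ z, expectedRegret mod h sol (drawAll mod p y.1) n (updateParameters mod h p b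
        (energyAll mod h (drawAll mod p y.1) z)) ∂stdNormals E := fun b =>
    (measurable_lintegral_update mod h hm b).comp
      (((measurable_drawAll mod p).comp measurable_fst).prodMk (measurable_const (a := p)))
  have hout := measurable_comp_playedArm mod h sol (measurable_const (a := p)) measurable_snd hin
  have hsplit : ∀ a, expectedRegret mod h sol (drawAll mod p a) (n + 1) p =
      (∫⁻ a', ENNReal.ofReal (gap mod h sol (drawAll mod p a) (playedArm mod h sol p a'))
        ∂stdNormals E) + ∫⁻ a', ∫⁻ z, expectedRegret mod h sol (drawAll mod p a) n
          (updateParameters mod h p (playedArm mod h sol p a')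
            (energyAll mod h (drawAll mod p a) z)) ∂stdNormals E ∂stdNormals E := fun a => by
    rw [expectedRegret_succ]
    exact lintegral_add_left (hgap.comp measurable_prodMk_left) _
  calc regretFrom mod h sol (n + 1) p
      = ∫⁻ a, expectedRegret mod h sol (drawAll mod p a) (n + 1) p ∂stdNormals E := rfl
    _ = _ := lintegral_congr hsplit
    _ = _ := lintegral_add_left hgap.lintegral_prod_right' _
    _ = _ := by
      congr 1
      -- The sample `a'` is independent of the truth; integrating it last fixes the arm before
      -- Bayes' rule is applied.
      refine (lintegral_lintegral_swap hout.aemeasurable).trans ?_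
      exact lintegral_congr fun a' => lintegral_lintegral_bayes mod h hp hu _ hm

end Regret

/-! ### The regret of a single round -/

theorem lintegral_lintegral_le_of_add_swap_le {α : Type*} [MeasurableSpace α] {μ : Measure α}
    [SFinite μ] {f g : α → α → ℝ≥0∞} (hf : Measurable (Function.uncurry f))
    (hg : Measurable (Function.uncurry g))
    (hfg : ∀ a a', g a a' + g a' a ≤ f a a' + f a' a) :
    ∫⁻ a, ∫⁻ a', g a a' ∂μ ∂μ ≤ ∫⁻ a, ∫⁻ a', f a a' ∂μ ∂μ := by
  have key : ∀ {k : α → α → ℝ≥0∞}, Measurable (Function.uncurry k) →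
      ∫⁻ a, ∫⁻ a', (k a a' + k a' a) ∂μ ∂μ = 2 * ∫⁻ a, ∫⁻ a', k a a' ∂μ ∂μ := fun {k} hk => by
    have h1 : ∀ a, ∫⁻ a', (k a a' + k a' a) ∂μ = ∫⁻ a', k a a' ∂μ + ∫⁻ a', k a' a ∂μ := fun a =>
      lintegral_add_left (hk.comp measurable_prodMk_left) _
    simp_rw [h1]
    have h2 : Measurable fun a => ∫⁻ a', k a a' ∂μ := hk.lintegral_prod_right'
    rw [lintegral_add_left h2, two_mul]
    congr 1
    exact (lintegral_lintegral_swap hk.aemeasurable).symm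
  have h := lintegral_mono (μ := μ) fun a => lintegral_mono (μ := μ) (hfg a)
  rw [key hf, key hg] at h
  exact (ENNReal.mul_le_mul_iff_right (by simp) (by simp)).1 h

theorem abs_le_young {x r l : ℝ} (hr : 0 < r) (hl : 0 < l) :
    |x| ≤ l * r / 2 + 1 / (2 * l * r) * x ^ 2 := by
  have e : l * r / 2 + 1 / (2 * l * r) * x ^ 2 - |x| = (l * r - |x|) ^ 2 / (2 * l * r) := by
    field_simp; rw [← sq_abs x]; ring
  have : 0 ≤ (l * r - |x|) ^ 2 / (2 * l * r) := by positivity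
  linarith

/-- Young's inequality is used with r = v c², linear in the variance, so that the first term sums
harmonically. The squares are summed over all edges: their mean then does not involve the played
arm, which is correlated with the sampled weights. -/
theorem sum_abs_le_young {ι : Type*} [Fintype ι] [DecidableEq ι] (b : Finset ι) (x : ι → ℝ)
    {v c : ι → ℝ} {k : ι → ℕ} {D l : ℝ} (hl : 0 < l) (hc : ∀ e, 0 < c e) (hv : ∀ e, 0 < v e)
    (hD : ∀ e, v e * c e ^ 2 * (k e + 1) ≤ D) :
    ∑ e ∈ b, ENNReal.ofReal |x e| ≤
      ∑ e, (if e ∈ b then ENNReal.ofReal (l * D / 2 * (1 / (k e + 1))) else 0) +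
        ∑ e, ENNReal.ofReal (1 / (2 * l * (v e * c e ^ 2))) * ENNReal.ofReal (x e ^ 2) := by
  rw [← Finset.sum_filter, Finset.filter_mem_eq_inter, Finset.univ_inter]
  refine le_trans (Finset.sum_le_sum fun e _ => ?_) ((Finset.sum_add_distrib).trans_le
    (add_le_add_right (Finset.sum_le_univ_sum_of_nonneg fun e => zero_le) _))
  have hr : 0 < v e * c e ^ 2 := mul_pos (hv e) (pow_pos (hc e) 2)
  have hD0 : v e * c e ^ 2 ≤ D * (1 / (k e + 1)) := by
    rw [mul_one_div, le_div_iff₀ (by positivity)]; exact hD e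
  have hD1 : 0 ≤ D * (1 / (k e + 1 : ℝ)) := hr.le.trans hD0
  rw [← ENNReal.ofReal_mul (by positivity),
    ← ENNReal.ofReal_add (by nlinarith) (by positivity)]
  refine ENNReal.ofReal_le_ofReal ((abs_le_young hr hl).trans ?_)
  nlinarith

theorem lintegral_lintegral_sq_sub_eval {ι : Type*} [Fintype ι] (e : ι) {W : ℝ → ℝ}
    (hW : Measurable W) :
    ∫⁻ a', ∫⁻ a, ENNReal.ofReal ((W (a e) - W (a' e)) ^ 2) ∂stdNormals ι ∂stdNormals ι =
      ∫⁻ x, ∫⁻ x', ENNReal.ofReal ((W x - W x') ^ 2) ∂stdNormal ∂stdNormal := by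
  have hm : Measurable fun y : ℝ × ℝ => ENNReal.ofReal ((W y.1 - W y.2) ^ 2) := by fun_prop
  rw [← lintegral_stdNormals_eval e hm.lintegral_prod_right']
  refine lintegral_congr fun a' => ?_
  rw [← lintegral_stdNormals_eval e (f := fun x => ENNReal.ofReal ((W (a' e) - W x) ^ 2))
    (by fun_prop)]
  refine lintegral_congr fun a => ?_
  rw [sub_sq_comm]

theorem lintegral_sum_abs_sub_le {ι : Type*} [Fintype ι] [DecidableEq ι]
    (A : (ι → ℝ) → Finset ι) {W : ι → ℝ → ℝ} {v : ι → ℝ≥0} {S : ι → ℝ≥0∞}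
    {c : ι → ℝ} {k : ι → ℕ} {D l : ℝ} (hl : 0 < l) (hc : ∀ e, 0 < c e) (hv : ∀ e, 0 < v e)
    (hD : ∀ e, (v e : ℝ) * c e ^ 2 * (k e + 1) ≤ D) (hW : ∀ e, Measurable (W e))
    (hS : ∀ e, ∫⁻ x, ∫⁻ x', ENNReal.ofReal ((W e x - W e x') ^ 2) ∂stdNormal ∂stdNormal ≤
      v e * S e) :
    ∫⁻ a', ∫⁻ a, ∑ e ∈ A a', ENNReal.ofReal |W e (a e) - W e (a' e)| ∂stdNormals ι ∂stdNormals ι ≤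
      ∫⁻ a', ∑ e, ((if e ∈ A a' then ENNReal.ofReal (l * D / 2 * (1 / (k e + 1))) else 0) +
        ENNReal.ofReal (1 / (2 * l * c e ^ 2)) * S e) ∂stdNormals ι := by
  have hv' : ∀ e, (0 : ℝ) < v e := hv
  have hsq : ∀ e, Measurable fun y : (ι → ℝ) × (ι → ℝ) =>
      ENNReal.ofReal ((W e (y.1 e) - W e (y.2 e)) ^ 2) := fun e => by
    have := hW e
    fun_prop
  have hsec : ∀ (a' : ι → ℝ) e, Measurable fun a : ι → ℝ =>
      ENNReal.ofReal ((W e (a e) - W e (a' e)) ^ 2) := fun a' e =>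
    (hsq e).comp measurable_prodMk_right
  have hin : ∀ e, Measurable fun a' : ι → ℝ => ∫⁻ a : ι → ℝ,
      ENNReal.ofReal ((W e (a e) - W e (a' e)) ^ 2) ∂stdNormals ι := fun e =>
    (hsq e).lintegral_prod_left'
  have hinner : ∀ a' : ι → ℝ, ∫⁻ a, (∑ e, (if e ∈ A a' then
        ENNReal.ofReal (l * D / 2 * (1 / (k e + 1))) else 0) +
      ∑ e, ENNReal.ofReal (1 / (2 * l * (v e * c e ^ 2))) *
        ENNReal.ofReal ((W e (a e) - W e (a' e)) ^ 2)) ∂stdNormals ι =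
      ∑ e, (if e ∈ A a' then ENNReal.ofReal (l * D / 2 * (1 / (k e + 1))) else 0) +
      ∑ e, ENNReal.ofReal (1 / (2 * l * (v e * c e ^ 2))) *
        ∫⁻ a : ι → ℝ, ENNReal.ofReal ((W e (a e) - W e (a' e)) ^ 2) ∂stdNormals ι := by
    intro a'
    rw [lintegral_add_left measurable_const, lintegral_const, measure_univ, mul_one,
      lintegral_finsetSum _ fun e _ => (hsec a' e).const_mul _]
    simp_rw [lintegral_const_mul' _ _ ENNReal.ofReal_ne_top]
  have hround : ∀ a' : ι → ℝ,
      ∫⁻ a, ∑ e ∈ A a', ENNReal.ofReal |W e (a e) - W e (a' e)| ∂stdNormals ι ≤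
      ∑ e, (if e ∈ A a' then ENNReal.ofReal (l * D / 2 * (1 / (k e + 1))) else 0) +
      ∑ e, ENNReal.ofReal (1 / (2 * l * (v e * c e ^ 2))) *
        ∫⁻ a : ι → ℝ, ENNReal.ofReal ((W e (a e) - W e (a' e)) ^ 2) ∂stdNormals ι := fun a' => by
    rw [← hinner]
    exact lintegral_mono fun a => sum_abs_le_young (A a')
      (fun e => W e (a e) - W e (a' e)) hl hc hv' hD
  refine (lintegral_mono hround).trans ?_
  simp_rw [Finset.sum_add_distrib]
  rw [lintegral_add_right _ measurable_const, lintegral_const, measure_univ, mul_one,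
    lintegral_add_right _ (Finset.measurable_sum _ fun e _ => (hin e).const_mul _),
    lintegral_finsetSum _ fun e _ => (hin e).const_mul _]
  refine add_le_add_right (Finset.sum_le_sum fun e _ => ?_) _
  rw [lintegral_const_mul' _ _ ENNReal.ofReal_ne_top, lintegral_lintegral_sq_sub_eval e (hW e)]
  refine (mul_le_mul_right (hS e) _).trans (le_of_eq ?_)
  have := hv' e
  have := hc e
  rw [← mul_assoc, ← ENNReal.ofReal_coe_nnreal, ← ENNReal.ofReal_mul (by positivity)]
  congr 2
  field_simp

section Regret

variable {V : Type*} {E : Finset (V × V)} {s t : V} (mod : EnergyModel) (h : E → EdgeHyper)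

/-- The weight of an edge as a function of the standard normal variable of its mean reward. -/
def drawWeight (p : E → ℝ × ℝ≥0) (e : E) (x : ℝ) : ℝ := (h e).weight mod (draw mod (p e) x)

theorem measurable_drawWeight (p : E → ℝ × ℝ≥0) (e : E) : Measurable (drawWeight mod h p e) :=
  ((h e).measurable_weight mod).comp (measurable_draw mod (p e))

variable [DecidableEq V] (sol : ShortestPathSolver E s t)

theorem gap_arm_nonneg (θ : E → ℝ) (w : E → ℝ) : 0 ≤ gap mod h sol θ (sol.arm w) :=
  sub_nonneg.2 (sol.arm_le _ _ (sol.arm_mem _))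

/-- Each path is optimal for one vector and played for the other, so regrouping the four sums by
path leaves only weight differences on the same path. -/
theorem gap_add_gap_le (θ θ' : E → ℝ) :
    ENNReal.ofReal (gap mod h sol θ (sol.arm (weights mod h θ'))) +
        ENNReal.ofReal (gap mod h sol θ' (sol.arm (weights mod h θ))) ≤
      ∑ e ∈ sol.arm (weights mod h θ'), ENNReal.ofReal |weights mod h θ e - weights mod h θ' e| +
        ∑ e ∈ sol.arm (weights mod h θ), ENNReal.ofReal |weights mod h θ' e - weights mod h θ e| := by
  rw [← ENNReal.ofReal_add (gap_arm_nonneg ..) (gap_arm_nonneg ..),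
    ← ENNReal.ofReal_sum_of_nonneg fun _ _ => abs_nonneg _,
    ← ENNReal.ofReal_sum_of_nonneg fun _ _ => abs_nonneg _,
    ← ENNReal.ofReal_add (Finset.sum_nonneg fun _ _ => abs_nonneg _)
      (Finset.sum_nonneg fun _ _ => abs_nonneg _)]
  refine ENNReal.ofReal_le_ofReal ?_
  have h1 := Finset.sum_le_sum fun e (_ : e ∈ sol.arm (weights mod h θ')) =>
    le_abs_self (weights mod h θ e - weights mod h θ' e)
  have h2 := Finset.sum_le_sum fun e (_ : e ∈ sol.arm (weights mod h θ)) =>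
    le_abs_self (weights mod h θ' e - weights mod h θ e)
  rw [Finset.sum_sub_distrib] at h1 h2
  simp only [gap]
  linarith

theorem lintegral_lintegral_gap_le_abs (p : E → ℝ × ℝ≥0) :
    ∫⁻ a, ∫⁻ a', ENNReal.ofReal (gap mod h sol (drawAll mod p a) (playedArm mod h sol p a'))
        ∂stdNormals E ∂stdNormals E ≤
      ∫⁻ a', ∫⁻ a, ∑ e ∈ playedArm mod h sol p a',
        ENNReal.ofReal |drawWeight mod h p e (a e) - drawWeight mod h p e (a' e)|
          ∂stdNormals E ∂stdNormals E := by
  have hf : Measurable (Function.uncurry fun a a' : E → ℝ => ∑ e ∈ playedArm mod h sol p a',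
      ENNReal.ofReal |drawWeight mod h p e (a e) - drawWeight mod h p e (a' e)|) :=
    measurable_comp_playedArm mod h sol (measurable_const (a := p)) measurable_snd
      (f := fun b (y : (E → ℝ) × (E → ℝ)) => ∑ e ∈ b,
        ENNReal.ofReal |drawWeight mod h p e (y.1 e) - drawWeight mod h p e (y.2 e)|) fun b =>
      Finset.measurable_sum _ fun e _ => by
        have := measurable_drawWeight mod h p e
        fun_prop
  refine le_of_le_of_eq ?_ (lintegral_lintegral_swap hf.aemeasurable)
  exact lintegral_lintegral_le_of_add_swap_le (g := fun a a' => ENNReal.ofReal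
    (gap mod h sol (drawAll mod p a) (playedArm mod h sol p a'))) hf
    (measurable_gap_playedArm mod h sol p).ennreal_ofReal fun a a' =>
      gap_add_gap_le mod h sol (drawAll mod p a) (drawAll mod p a')

theorem lintegral_lintegral_gap_le {p : E → ℝ × ℝ≥0} {c : E → ℝ} {k : E → ℕ} {D l : ℝ}
    (hl : 0 < l) (hc : ∀ e, 0 < c e) (hp : ∀ e, 0 < (p e).2)
    (hD : ∀ e, ((p e).2 : ℝ) * c e ^ 2 * (k e + 1) ≤ D) :
    ∫⁻ a, ∫⁻ a', ENNReal.ofReal (gap mod h sol (drawAll mod p a) (playedArm mod h sol p a'))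
        ∂stdNormals E ∂stdNormals E ≤
      ∫⁻ a', ∑ e, ((if e ∈ playedArm mod h sol p a' then ENNReal.ofReal (l * D / 2 * (1 / (k e + 1)))
          else 0) + ENNReal.ofReal (1 / (2 * l * c e ^ 2)) * fluctuation mod (p e))
        ∂stdNormals E :=
  (lintegral_lintegral_gap_le_abs mod h sol p).trans
    (lintegral_sum_abs_sub_le (playedArm mod h sol p) hl hc hp hD
      (measurable_drawWeight mod h p) fun e => (h e).lintegral_sq_weight_sub_le mod (p e))

/-- For a played edge, v' c² (k + 2) is the average of v c² (k + 1) and u c² with weights u / (v +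
u) and v / (v + u), and both are at most `D`. -/
theorem posteriorAll_var_bounds {p : E → ℝ × ℝ≥0} {c : E → ℝ} {k : E → ℕ} {D : ℝ}
    (hu : ∀ e, 0 < (h e).obsVar mod)
    (huD : ∀ e, ((h e).obsVar mod : ℝ) * c e ^ 2 ≤ D) (hp : ∀ e, 0 < (p e).2)
    (hD : ∀ e, ((p e).2 : ℝ) * c e ^ 2 * (k e + 1) ≤ D) (b : Finset E) (x : E → ℝ) (e : E) :
    0 < (posteriorAll mod h p b x e).2 ∧
      ((posteriorAll mod h p b x e).2 : ℝ) * c e ^ 2 * ((k e + if e ∈ b then 1 else 0 : ℕ) + 1) ≤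
        D := by
  simp only [posteriorAll]
  split_ifs with he
  · have h1 := hu e
    have h2 := hp e
    have h1' : (0 : ℝ) < (h e).obsVar mod := h1
    have h2' : (0 : ℝ) < (p e).2 := h2
    have h3 := EdgeHyper.posterior_var h1 h2 (p e).1 (x e)
    refine ⟨?_, ?_⟩
    · rw [← NNReal.coe_pos, h3]; positivity
    · rw [h3]
      have e1 : ((p e).2 : ℝ) * (h e).obsVar mod / ((p e).2 + (h e).obsVar mod) * c e ^ 2 *
          ((k e + 1 : ℕ) + 1) = ((h e).obsVar mod * ((p e).2 * c e ^ 2 * (k e + 1)) +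
            (p e).2 * ((h e).obsVar mod * c e ^ 2)) / ((p e).2 + (h e).obsVar mod) := by
        push_cast; field_simp
      rw [e1, div_le_iff₀ (by positivity)]
      nlinarith [mul_le_mul_of_nonneg_left (hD e) h1'.le, mul_le_mul_of_nonneg_left (huD e) h2'.le]
  · exact ⟨hp e, by simpa using hD e⟩

theorem lintegral_fluctuation_posteriorAll {p : E → ℝ × ℝ≥0} (hu : ∀ e, 0 < (h e).obsVar mod)
    (hp : ∀ e, 0 < (p e).2) (b : Finset E) (e : E) :
    ∫⁻ x, fluctuation mod (posteriorAll mod h p b x e) ∂stdNormals E = fluctuation mod (p e) := by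
  simp only [posteriorAll]
  split_ifs with he
  · rw [← EdgeHyper.lintegral_fluctuation_posterior mod (hu e) (hp e)]
    exact lintegral_stdNormals_eval e
      ((measurable_fluctuation mod).comp (EdgeHyper.measurable_posterior _ _))
  · simp

/-! ### Summation over the rounds -/

/-- The sum `1 / (k + 1) + ⋯ + 1 / (k + n)`. -/
def harmonicTail (k n : ℕ) : ℝ := ∑ j ∈ Finset.range n, 1 / ((k + j : ℕ) + 1 : ℝ)

theorem harmonicTail_nonneg (k n : ℕ) : 0 ≤ harmonicTail k n :=
  Finset.sum_nonneg fun _ _ => by positivity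

theorem harmonicTail_succ (k n : ℕ) :
    harmonicTail k (n + 1) = 1 / (k + 1) + harmonicTail (k + 1) n := by
  rw [harmonicTail, Finset.sum_range_succ', add_comm]
  simp only [harmonicTail, add_zero]
  congr 1
  refine Finset.sum_congr rfl fun j _ => ?_
  congr 3; ring

theorem harmonicTail_le_succ (k n : ℕ) : harmonicTail k n ≤ harmonicTail k (n + 1) := by
  rw [harmonicTail, harmonicTail, Finset.sum_range_succ]
  exact le_add_of_nonneg_right (by positivity)

theorem harmonicTail_zero_le (n : ℕ) : harmonicTail 0 n ≤ 1 + Real.log n := by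
  have := harmonic_le_one_add_log n
  refine le_trans (le_of_eq ?_) this
  simp [harmonicTail, harmonic]

/-- The counter `k` of observations per edge is carried along with the parameters; the bound D / (k
+ 1) on the scaled variance is the invariant of the induction. The bound is affine in the
fluctuations, so it can be averaged over the posterior. -/
theorem regretFrom_le {c : E → ℝ} {D l : ℝ} (hl : 0 < l) (hc : ∀ e, 0 < c e) (hD0 : 0 ≤ D)
    (hu : ∀ e, 0 < (h e).obsVar mod) (huD : ∀ e, ((h e).obsVar mod : ℝ) * c e ^ 2 ≤ D) (n : ℕ) :
    ∀ (p : E → ℝ × ℝ≥0) (k : E → ℕ), (∀ e, 0 < (p e).2) →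
      (∀ e, ((p e).2 : ℝ) * c e ^ 2 * (k e + 1) ≤ D) →
      regretFrom mod h sol n p ≤
        ∑ e, (n * (ENNReal.ofReal (1 / (2 * l * c e ^ 2)) * fluctuation mod (p e)) +
          ENNReal.ofReal (l * D / 2 * harmonicTail (k e) n)) := by
  induction n with
  | zero => intro p k _ _; simp [regretFrom, expectedRegret]
  | succ n ih =>
    intro p k hp hD
    set S : E → (ℝ × ℝ≥0) → ℝ≥0∞ := fun e q =>
      ENNReal.ofReal (1 / (2 * l * c e ^ 2)) * fluctuation mod q
    have hSm : ∀ e b, Measurable fun x : E → ℝ => (n : ℝ≥0∞) * S e (posteriorAll mod h p b x e) := by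
      intro e b
      refine (((measurable_fluctuation mod).comp ?_).const_mul _).const_mul _
      simp only [posteriorAll]
      split_ifs
      · exact (EdgeHyper.measurable_posterior _ _).comp (measurable_pi_apply e)
      · exact measurable_const
    have hnext : ∀ b, ∫⁻ x, regretFrom mod h sol n (posteriorAll mod h p b x) ∂stdNormals E ≤
        ∑ e, (n * S e (p e) + ENNReal.ofReal
          (l * D / 2 * harmonicTail (k e + if e ∈ b then 1 else 0) n)) := fun b => by
      refine (lintegral_mono fun x => ih _ (fun e => k e + if e ∈ b then 1 else 0)
        (fun e => (posteriorAll_var_bounds mod h hu huD hp hD b x e).1)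
        (fun e => (posteriorAll_var_bounds mod h hu huD hp hD b x e).2)).trans (le_of_eq ?_)
      rw [lintegral_finsetSum _ fun e _ => (hSm e b).add_const _]
      refine Finset.sum_congr rfl fun e _ => ?_
      rw [lintegral_add_right _ measurable_const, lintegral_const, measure_univ, mul_one,
        lintegral_const_mul' _ _ (ENNReal.natCast_ne_top n),
        lintegral_const_mul' _ _ ENNReal.ofReal_ne_top,
        lintegral_fluctuation_posteriorAll mod h hu hp]
    rw [regretFrom_succ mod h sol hp hu]
    have hround : Measurable fun a' : E → ℝ => ∑ e, ((if e ∈ playedArm mod h sol p a' then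
        ENNReal.ofReal (l * D / 2 * (1 / (k e + 1))) else 0) + S e (p e)) :=
      measurable_comp_playedArm mod h sol (measurable_const (a := p)) measurable_id
        (f := fun b _ => ∑ e, ((if e ∈ b then
          ENNReal.ofReal (l * D / 2 * (1 / (k e + 1))) else 0) + S e (p e)))
        fun b => measurable_const
    refine (add_le_add (lintegral_lintegral_gap_le mod h sol hl hc hp hD)
      (lintegral_mono fun a' => hnext (playedArm mod h sol p a'))).trans ?_
    rw [← lintegral_add_left hround]
    refine (lintegral_mono (g := fun _ => ∑ e, (((n + 1 : ℕ) : ℝ≥0∞) * S e (p e) +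
      ENNReal.ofReal (l * D / 2 * harmonicTail (k e) (n + 1)))) fun a' => ?_).trans
      (by rw [lintegral_const, measure_univ, mul_one])
    dsimp only
    rw [← Finset.sum_add_distrib]
    refine Finset.sum_le_sum fun e _ => ?_
    have hlD : 0 ≤ l * D / 2 := by positivity
    have hstep : (if e ∈ playedArm mod h sol p a' then ENNReal.ofReal (l * D / 2 * (1 / (k e + 1)))
        else 0) + ENNReal.ofReal (l * D / 2 *
          harmonicTail (k e + if e ∈ playedArm mod h sol p a' then 1 else 0) n) ≤
        ENNReal.ofReal (l * D / 2 * harmonicTail (k e) (n + 1)) := by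
      -- A played edge pays the first term of its harmonic tail and raises its counter, with
      -- equality; an unplayed edge keeps its counter and loses only the last term of the tail.
      split_ifs
      · rw [← ENNReal.ofReal_add (by positivity) (mul_nonneg hlD (harmonicTail_nonneg _ _)),
          harmonicTail_succ, mul_add]
      · rw [zero_add, add_zero]
        exact ENNReal.ofReal_le_ofReal
          (mul_le_mul_of_nonneg_left (harmonicTail_le_succ _ _) hlD)
    push_cast
    refine le_trans (le_of_eq ?_) (add_le_add_right hstep ((n + 1) * S e (p e)))
    ring

theorem bayesRegret_le {M : ℝ} (hb : ∀ e, (h e).BoundedBy M mod) {T : ℕ} (hT : 0 < T) :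
    bayesRegret mod h sol T ≤ ENNReal.ofReal (E.card * (√T *
      (2 * (1 + M ^ 2) + (M ^ 2 + M ^ 4) / 2 * (1 + Real.log T)))) := by
  have hT' : (0 : ℝ) < T := Nat.cast_pos.2 hT
  have hl : 0 < √(T : ℝ) := Real.sqrt_pos.2 hT'
  have hlog : 0 ≤ Real.log T := Real.log_natCast_nonneg T
  have hpr := fun e => (hb e).prior_bounds
  rw [bayesRegret_eq_regretFrom]
  -- The choice l = √T balances T / l against l log T, and all counters start at 0.
  refine (regretFrom_le mod h sol (c := fun e => (h e).scale mod) (D := M ^ 2 + M ^ 4) hl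
    (fun e => (hpr e).1) (by positivity) (fun e => (hpr e).2.2.1) (fun e => (hpr e).2.2.2.2.1) T _
    (fun _ => 0) (fun e => (hpr e).2.1) (fun e => by simpa using (hpr e).2.2.2.1)).trans ?_
  refine (Finset.sum_le_card_nsmul _ _ (ENNReal.ofReal (√T *
      (2 * (1 + M ^ 2) + (M ^ 2 + M ^ 4) / 2 * (1 + Real.log T)))) fun e _ => ?_).trans ?_
  · have hc : (0 : ℝ) < (h e).scale mod := (hpr e).1
    refine (add_le_add_left (mul_le_mul_right (mul_le_mul_right (hpr e).2.2.2.2.2 _) _) _).trans ?_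
    rw [← ENNReal.ofReal_natCast, ← ENNReal.ofReal_mul (by positivity),
      ← ENNReal.ofReal_mul (by positivity), ← ENNReal.ofReal_add (by positivity)
        (mul_nonneg (by positivity) (harmonicTail_nonneg _ _))]
    refine ENNReal.ofReal_le_ofReal ?_
    have e1 : (T : ℝ) * (1 / (2 * √T * ((h e).scale mod : ℝ) ^ 2) *
        (4 * (1 + M ^ 2) * ((h e).scale mod : ℝ) ^ 2)) = √T * (2 * (1 + M ^ 2)) := by
      have := Real.sq_sqrt hT'.le
      field_simp
      rw [this]; ring
    have e2 := mul_le_mul_of_nonneg_left (harmonicTail_zero_le T)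
      (by positivity : 0 ≤ √(T : ℝ) * (M ^ 2 + M ^ 4) / 2)
    rw [e1]
    linarith
  · rw [Finset.card_univ, Fintype.card_coe, nsmul_eq_mul, ← ENNReal.ofReal_natCast,
      ← ENNReal.ofReal_mul (by positivity)]

end Regret
end Navigation

end

/-! ### The stated form of the bound -/

theorem mainTheorem5 (mod : Navigation.EnergyModel) (M : ℝ) :
    ∃ (C : ℝ) (k : ℕ),
      ∀ (V : Type*) [Fintype V] [DecidableEq V] (E : Finset (V × V)) (s t : V)
        (sol : Navigation.ShortestPathSolver E s t) (h : E → Navigation.EdgeHyper),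
        (∀ e ∈ E, e.1 ≠ e.2) → (∀ e, (h e).BoundedBy M mod) →
        ∀ T : ℕ,
          Navigation.bayesRegret mod h sol T ≤
            ENNReal.ofReal (C * (Fintype.card V : ℝ) ^ 2 * √((E.card : ℝ) * (T : ℝ)) *
              (1 + Real.log ((Fintype.card V : ℝ) * (E.card : ℝ) * (T : ℝ))) ^ k) := by
  refine ⟨2 * (1 + M ^ 2) + (M ^ 2 + M ^ 4) / 2, 1, fun V _ _ E s t sol h _ hb T => ?_⟩
  -- The horizon 0 is separate because Young's parameter √T must be positive.
  rcases Nat.eq_zero_or_pos T with rfl | hT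
  · simp [Navigation.bayesRegret, Navigation.expectedRegret]
  refine (Navigation.bayesRegret_le mod h sol hb hT).trans (ENNReal.ofReal_le_ofReal ?_)
  rcases Nat.eq_zero_or_pos E.card with hE | hE
  · simp [hE]
  have hV : 0 < Fintype.card V := Fintype.card_pos_iff.2 ⟨s⟩
  have hEV : (E.card : ℝ) ≤ (Fintype.card V : ℝ) ^ 2 := by
    have := Finset.card_le_univ E
    rw [Fintype.card_prod, ← sq] at this
    exact_mod_cast this
  have hV1 : (1 : ℝ) ≤ Fintype.card V := by exact_mod_cast hV
  have hE1 : (1 : ℝ) ≤ E.card := by exact_mod_cast hE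
  have hT1 : (1 : ℝ) ≤ T := by exact_mod_cast hT
  have hlog0 : 0 ≤ Real.log T := Real.log_nonneg hT1
  have hlog : Real.log T ≤ Real.log ((Fintype.card V : ℝ) * (E.card : ℝ) * (T : ℝ)) := by
    refine Real.log_le_log (by linarith) ?_
    exact le_mul_of_one_le_left (by linarith) (one_le_mul_of_one_le_of_one_le hV1 hE1)
  have hsqrt : (E.card : ℝ) * √T ≤ (Fintype.card V : ℝ) ^ 2 * √((E.card : ℝ) * T) := by
    -- Even √|E| ≤ |V| holds; the stated bound leaves a factor |V| to spare.
    have h1 : √(E.card : ℝ) ≤ (Fintype.card V : ℝ) ^ 2 :=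
      (Real.sqrt_le_iff.2 ⟨by linarith, hEV⟩).trans (le_self_pow₀ hV1 two_ne_zero)
    have h2 := Real.mul_self_sqrt (by linarith : (0 : ℝ) ≤ E.card)
    rw [Real.sqrt_mul (by linarith)]
    calc (E.card : ℝ) * √T = √(E.card : ℝ) * (√(E.card : ℝ) * √T) := by rw [← mul_assoc, h2]
      _ ≤ _ := mul_le_mul_of_nonneg_right h1 (by positivity)
  set A := 2 * (1 + M ^ 2)
  set B := (M ^ 2 + M ^ 4) / 2
  have hA : 0 ≤ A := by positivity
  have hB : 0 ≤ B := by positivity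
  calc (E.card : ℝ) * (√T * (A + B * (1 + Real.log T)))
      ≤ (E.card : ℝ) * (√T * ((A + B) * (1 + Real.log T))) := by
        gcongr
        nlinarith [mul_nonneg hA hlog0]
    _ = (A + B) * ((E.card : ℝ) * √T) * (1 + Real.log T) := by ring
    _ ≤ (A + B) * ((Fintype.card V : ℝ) ^ 2 * √((E.card : ℝ) * T)) *
        (1 + Real.log ((Fintype.card V : ℝ) * (E.card : ℝ) * (T : ℝ))) := by gcongr
    _ = _ := by ring
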